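/- Let $p:\mathbb R\to\mathbb R$ be measurable with $\inf_{x\in\mathbb R}p(x)>0$, and let $A_p f=-(pf')'$ be the maximal operator in (complex) $L^2(\mathbb R)$ with domain $\{f\in L^2(\mathbb R): f,\,pf'\in AC_{loc}(\mathbb R),\ (pf')'\in L^2(\mathbb R)\}$; this operator is self-adjoint. Let $\Omega>0$, let $\Lambda\subseteq[0,\Omega]$ be a Borel set, let $P_\Lambda=c_\Lambda(A_p)$ be the spectral projection of $A_p$ for $\Lambda$, and let $PW_\Lambda(A_p)=\{f\in L^2(\mathbb R): f=P_\Lambda f\}$; its elements have continuous representatives, by means of which point values are understood. Let $(x_i)_{i\in\mathbb Z}$ be an increasing sequence of real numbers with $\lim_{i\to\pm\infty}x_i=\pm\infty$, put $y_i=\tfrac12(x_i+x_{i+1})$, let $\chi_i$ be the characteristic function of $[y_{i-1},y_i)$, and assume the maximal gap condition $$\delta=\sup_{i\in\mathbb Z}\frac{x_{i+1}-x_i}{\inf_{x\in[x_i,x_{i+1}]}\sqrt{p(x)}}<\frac{\pi}{\Omega^{1/2}} .$$ Then every $f\in PW_\Lambda(A_p)$ is reconstructed from its samples $(f(x_i))_{i\in\mathbb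 Z}$ by the following algorithm. Set $$f_0=h_0=P_\Lambda\Big(\sum_{i\in\mathbb Z}f(x_i)\chi_i\Big),\qquad h_{n+1}=h_n-P_\Lambda\Big(\sum_{i\in\mathbb Z}h_n(x_i)\chi_i\Big),\qquad f_{n+1}=f_n+h_{n+1}\qquad(n\ge 0).$$ All the sums $\sum_i f(x_i)\chi_i$ and $\sum_i h_n(x_i)\chi_i$ belong to $L^2(\mathbb R)$, all $h_n$ belong to $PW_\Lambda(A_p)$, and $$f=\lim_{n\to\infty}f_n=\sum_{n=0}^\infty h_n\quad\text{in }L^2(\mathbb R),$$ with the error estimate, for all $n\ge 0$, $$\|f-f_n\|\le\Big(\frac{\delta\,\Omega^{1/2}}{\pi}\Big)^{n+1}\,\frac{\pi+\delta\,\Omega^{1/2}}{\pi-\delta\,\Omega^{1/2}}\,\|f\| .$$ -/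

import Mathlib

open MeasureTheory Filter Topology

namespace VarBandwidth

noncomputable section

/-! ### Projection-valued measures and spectral projections -/

/-- A projection-valued measure on the Borel sets of `ℝ` with values in the orthogonal projections
of the Hilbert space `H`; it is countably additive in the strong operator topology. -/
structure ProjectionValuedMeasure (H : Type*) [NormedAddCommGroup H] [InnerProductSpace ℂ H]
    [CompleteSpace H] where
  /-- The projection attached to a Borel set (the values on other sets are irrelevant). -/
  proj : Set ℝ → (H →L[ℂ] H)
  isStarProjection : ∀ S, MeasurableSet S → IsStarProjection (proj S)
  empty : proj ∅ = 0
  univ : proj Set.univ = 1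
  inter : ∀ S T, MeasurableSet S → MeasurableSet T → proj (S ∩ T) = proj S * proj T
  iUnion : ∀ S : ℕ → Set ℝ, (∀ n, MeasurableSet (S n)) → Pairwise (Function.onFun Disjoint S) →
    ∀ f : H, HasSum (fun n => proj (S n) f) (proj (⋃ n, S n) f)

namespace ProjectionValuedMeasure

variable {H : Type*} [NormedAddCommGroup H] [InnerProductSpace ℂ H] [CompleteSpace H]

theorem re_inner_proj_nonneg (E : ProjectionValuedMeasure H) (f : H) (S : Set ℝ)
    (hS : MeasurableSet S) : 0 ≤ (inner ℂ f (E.proj S f)).re := by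
  have h := E.isStarProjection S hS
  have hidem : E.proj S (E.proj S f) = E.proj S f :=
    congrArg (fun T : H →L[ℂ] H => T f) h.isIdempotentElem
  have hadj : ContinuousLinearMap.adjoint (E.proj S) = E.proj S := h.isSelfAdjoint
  have key : inner ℂ f (E.proj S f) = inner ℂ (E.proj S f) (E.proj S f) := by
    rw [← ContinuousLinearMap.adjoint_inner_right, hadj, hidem]
  rw [key]
  exact inner_self_nonneg (𝕜 := ℂ)

/-- The scalar spectral measure `μ_f(S) = ⟨f, E(S) f⟩` of a vector `f`. -/
def scalarMeasure (E : ProjectionValuedMeasure H) (f : H) : Measure ℝ :=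
  Measure.ofMeasurable (fun S _ => ENNReal.ofReal (inner ℂ f (E.proj S f)).re)
    (by simp [E.empty])
    (by
      intro S hS hd
      have h1 := (E.iUnion S hS hd f).mapL (innerSL ℂ f)
      have h2 := Complex.hasSum_re h1
      simp only [innerSL_apply_apply] at h2
      rw [← h2.tsum_eq]
      exact ENNReal.ofReal_tsum_of_nonneg
        (fun n => E.re_inner_proj_nonneg f (S n) (hS n)) h2.summable)

/-- `E` is the spectral measure (resolution of the identity) of the unbounded operator `A`, that is
`A = ∫ λ dE(λ)`: the domain of `A` consists of the `f` with `∫ λ² dμ_f(λ) < ∞`, and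
`⟨f, A f⟩ = ∫ λ dμ_f(λ)` there. -/
structure IsSpectralMeasureOf (E : ProjectionValuedMeasure H) (A : H →ₗ.[ℂ] H) : Prop where
  mem_domain_iff : ∀ f : H,
    f ∈ A.domain ↔ ∫⁻ l, ENNReal.ofReal (l ^ 2) ∂(E.scalarMeasure f) < ⊤
  inner_apply : ∀ f : A.domain,
    inner ℂ (f : H) (A f) = ((∫ l, l ∂(E.scalarMeasure (f : H)) : ℝ) : ℂ)

end ProjectionValuedMeasure

open Classical in
/-- The spectral projection `c_S(A)` of an operator `A` for the Borel set `S`: the value `E(S)` of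
the spectral measure `E` of `A`. By the spectral theorem a self-adjoint `A` has exactly one
spectral measure; an operator without a spectral measure gets the junk value `0`. -/
def spectralProjection {H : Type*} [NormedAddCommGroup H] [InnerProductSpace ℂ H]
    [CompleteSpace H] (A : H →ₗ.[ℂ] H) (S : Set ℝ) : H →L[ℂ] H :=
  if h : ∃ E : ProjectionValuedMeasure H, E.IsSpectralMeasureOf A then h.choose.proj S else 0

/-! ### The Sturm-Liouville operator `A_p f = -(p f')'` -/

/-- Complex-valued `L²(ℝ)`. -/
abbrev L2R : Type := Lp ℂ 2 (volume : Measure ℝ)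

/-- Locally absolutely continuous functions on `ℝ`. -/
def ACLoc (F : ℝ → ℂ) : Prop := ∀ a b : ℝ, AbsolutelyContinuousOnInterval F a b

theorem ACLoc.continuous {F : ℝ → ℂ} (h : ACLoc F) : Continuous F := by
  rw [continuous_iff_continuousAt]
  intro t
  have hlt : t - 1 < t + 1 := by linarith
  have h1 := (h (t - 1) (t + 1)).continuousOn
  rw [Set.uIcc_of_le hlt.le] at h1
  exact h1.continuousAt (Icc_mem_nhds (by linarith) (by linarith))

theorem ACLoc.ae_differentiableAt {F : ℝ → ℂ} (h : ACLoc F) :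
    ∀ᵐ t : ℝ, DifferentiableAt ℝ F t := by
  have h1 : ∀ n : ℕ, ∀ᵐ t : ℝ, t ∈ Set.uIcc (-(n : ℝ)) n → DifferentiableAt ℝ F t := fun n =>
    (h (-(n : ℝ)) n).boundedVariationOn.ae_differentiableAt_of_mem_uIcc
  filter_upwards [ae_all_iff.2 h1] with t ht
  obtain ⟨n, hn⟩ := exists_nat_ge |t|
  refine ht n ?_
  rw [Set.uIcc_of_le (by linarith [abs_nonneg t])]
  exact abs_le.1 hn

/-- `SLRel p f g` says that `f` lies in the domain of the maximal operator `A_p` and that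
`g = A_p f = -(p f')'`: the class `f` has a locally absolutely continuous representative `F`, the
function `p F'` agrees almost everywhere with a locally absolutely continuous function `G`, and
`g ∈ L²(ℝ)` is `-G'`. -/
def SLRel (p : ℝ → ℝ) (f g : L2R) : Prop :=
  ∃ F G : ℝ → ℂ, ACLoc F ∧ ACLoc G ∧ f =ᵐ[volume] F ∧
    (G =ᵐ[volume] fun t => (p t : ℂ) * deriv F t) ∧ g =ᵐ[volume] fun t => -deriv G t

/-- The graph of the maximal operator `A_p`. -/
def slGraph (p : ℝ → ℝ) : Submodule ℂ (L2R × L2R) where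
  carrier := {z | SLRel p z.1 z.2}
  zero_mem' := by
    have h0 : ACLoc (fun _ => (0 : ℂ)) := fun a b => by
      simpa [AbsolutelyContinuousOnInterval] using tendsto_const_nhds
    refine ⟨fun _ => 0, fun _ => 0, h0, h0, ?_, ?_, ?_⟩
    · exact Lp.coeFn_zero ℂ 2 volume
    · simp
    · filter_upwards [Lp.coeFn_zero ℂ 2 (volume : Measure ℝ)] with t ht
      simp
  add_mem' := by
    rintro ⟨f₁, g₁⟩ ⟨f₂, g₂⟩ ⟨F₁, G₁, hF₁, hG₁, hf₁, hp₁, hg₁⟩ ⟨F₂, G₂, hF₂, hG₂, hf₂, hp₂, hg₂⟩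
    refine ⟨F₁ + F₂, G₁ + G₂, fun a b => (hF₁ a b).add (hF₂ a b),
      fun a b => (hG₁ a b).add (hG₂ a b), ?_, ?_, ?_⟩
    · exact (Lp.coeFn_add f₁ f₂).trans (hf₁.add hf₂)
    · filter_upwards [hp₁, hp₂, hF₁.ae_differentiableAt, hF₂.ae_differentiableAt]
        with t h1 h2 d1 d2
      rw [deriv_add d1 d2, Pi.add_apply, h1, h2, mul_add]
    · filter_upwards [Lp.coeFn_add g₁ g₂, hg₁, hg₂, hG₁.ae_differentiableAt,
        hG₂.ae_differentiableAt] with t h0 h1 h2 d1 d2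
      change (↑↑(g₁ + g₂) : ℝ → ℂ) t = _
      rw [deriv_add d1 d2, h0, Pi.add_apply, h1, h2, neg_add]
  smul_mem' := by
    rintro c ⟨f, g⟩ ⟨F, G, hF, hG, hf, hp, hg⟩
    refine ⟨fun t => c • F t, fun t => c • G t, fun a b => (hF a b).const_smul c,
      fun a b => (hG a b).const_smul c, ?_, ?_, ?_⟩
    · exact (Lp.coeFn_smul c f).trans (hf.const_smul c)
    · filter_upwards [hp, hF.ae_differentiableAt] with t h1 d1
      rw [deriv_fun_const_smul c d1, h1, smul_eq_mul, smul_eq_mul]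
      ring
    · filter_upwards [Lp.coeFn_smul c g, hg, hG.ae_differentiableAt] with t h0 h1 d1
      change (↑↑(c • g) : ℝ → ℂ) t = _
      rw [deriv_fun_const_smul c d1, h0, Pi.smul_apply, h1, smul_neg]

/-- The relation defining `A_p` is single-valued. -/
theorem slGraph_functional (p : ℝ → ℝ) (z : L2R × L2R) (hz : z ∈ slGraph p) (h0 : z.1 = 0) :
    z.2 = 0 := by
  obtain ⟨F, G, hF, hG, hf, hp, hg⟩ := hz
  have hF0 : F = fun _ => 0 := by
    refine (hF.continuous.ae_eq_iff_eq (μ := (volume : Measure ℝ)) continuous_const).1 ?_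
    rw [h0] at hf
    exact hf.symm.trans (Lp.coeFn_zero ℂ 2 volume)
  have hG0 : G = fun _ => 0 := by
    refine (hG.continuous.ae_eq_iff_eq (μ := (volume : Measure ℝ)) continuous_const).1 ?_
    filter_upwards [hp] with t ht
    simpa [hF0] using ht
  refine Lp.ext ?_
  filter_upwards [hg, Lp.coeFn_zero ℂ 2 (volume : Measure ℝ)] with t h1 h2
  rw [h1, h2, hG0]
  simp

/-- The maximal operator `A_p f = -(p f')'` in `L²(ℝ)`, with domain
`{f ∈ L²(ℝ) : f, p f' ∈ AC_loc, (p f')' ∈ L²(ℝ)}`. -/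
def slOperator (p : ℝ → ℝ) : L2R →ₗ.[ℂ] L2R := (slGraph p).toLinearPMap

theorem mem_graph_slOperator (p : ℝ → ℝ) (f g : L2R) :
    (f, g) ∈ (slOperator p).graph ↔ SLRel p f g := by
  rw [slOperator, Submodule.toLinearPMap_graph_eq _ (slGraph_functional p)]
  exact Iff.rfl

/-- `P_Λ = c_Λ(A_p)`. -/
def pwProj (p : ℝ → ℝ) (L : Set ℝ) : L2R →L[ℂ] L2R := spectralProjection (slOperator p) L

/-- The Paley-Wiener space `PW_Λ(A_p)`, i.e. all `f ∈ L²(ℝ)` with `f = c_Λ(A_p) f`. -/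
def PW (p : ℝ → ℝ) (L : Set ℝ) : Set L2R := {f | f = pwProj p L f}

/-! ### Sampling -/

/-- The class `f` has a continuous representative. -/
def HasContRep (f : L2R) : Prop := ∃ F : ℝ → ℂ, Continuous F ∧ f =ᵐ[volume] F

open Classical in
/-- The point value `f(t)`, read off the (unique) continuous representative of `f`. -/
def pointValue (f : L2R) (t : ℝ) : ℂ := if h : HasContRep f then h.choose t else f t

/-- The sequence of samples `(f(x_i))_{i ∈ ℤ}`. -/
def samples (x : ℤ → ℝ) (f : L2R) : ℤ → ℂ := fun i => pointValue f (x i)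

/-- The midpoints `y_i = (x_i + x_{i+1}) / 2`. -/
def midpt (x : ℤ → ℝ) (i : ℤ) : ℝ := (x i + x (i + 1)) / 2

/-- The characteristic function `χ_i` of `[y_{i-1}, y_i)`. -/
def chi (x : ℤ → ℝ) (i : ℤ) : ℝ → ℂ :=
  Set.indicator (Set.Ico (midpt x (i - 1)) (midpt x i)) 1

/-- The step function `∑_i c_i χ_i` (at each point at most one term is nonzero). -/
def stepFun (x : ℤ → ℝ) (c : ℤ → ℂ) : ℝ → ℂ := fun t => ∑' i : ℤ, c i * chi x i t

open Classical in
/-- `∑_i c_i χ_i` as an element of `L²(ℝ)` (junk value `0` if it is not square-integrable). -/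
def stepL2 (x : ℤ → ℝ) (c : ℤ → ℂ) : L2R :=
  if h : MemLp (stepFun x c) 2 (volume : Measure ℝ) then h.toLp (stepFun x c) else 0

/-- The weighted gap `(x_{i+1} - x_i) / inf_{[x_i, x_{i+1}]} √p`. -/
def weightedGap (p : ℝ → ℝ) (x : ℤ → ℝ) (i : ℤ) : ℝ :=
  (x (i + 1) - x i) / ⨅ t : Set.Icc (x i) (x (i + 1)), √(p t)

/-- The increments `h_n` of the reconstruction algorithm, computed from the sampled values `c`:
`h_0 = P_Λ(∑ c_i χ_i)` and `h_{n+1} = h_n - P_Λ(∑ h_n(x_i) χ_i)`. -/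
def increment (p : ℝ → ℝ) (L : Set ℝ) (x : ℤ → ℝ) (c : ℤ → ℂ) : ℕ → L2R
  | 0 => pwProj p L (stepL2 x c)
  | n + 1 => increment p L x c n - pwProj p L (stepL2 x (samples x (increment p L x c n)))

/-- The approximations `f_0 = h_0`, `f_{n+1} = f_n + h_{n+1}`. -/
def approx (p : ℝ → ℝ) (L : Set ℝ) (x : ℤ → ℝ) (c : ℤ → ℂ) : ℕ → L2R
  | 0 => increment p L x c 0
  | n + 1 => approx p L x c n + increment p L x c (n + 1)

end

end VarBandwidth

/-! Let `S g` be the step function built from the samples of `g`, `P` the spectral projection and `V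
= P ∘ S`. Everything rests on one estimate on the Paley-Wiener space: `‖g - S g‖ ≤ γ ‖g‖` with `γ =
δ √Ω / π < 1`. As `g = P g`, we have `g - V g = P (g - S g)`, so `I - V` contracts by `γ`, and the
algorithm is the Neumann series inverting `V` (`iteration_converges`).

The estimate has two halves. Locally, each cell `[y_{i-1}, y_i)` is cut at `x_i`; on either piece `g
- g(x_i)` vanishes at one end, and Wirtinger's inequality bounds its square integral by `(2 · length
/ π)²` times that of `g'`. Twice the length is at most the gap, and the gap condition trades the gap
for `δ √p`; summation gives `‖g - S g‖² ≤ (δ/π)² ∫ p |g'|²` (`lintegral_sub_stepFun_le`). Globally,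
integration by parts bounds the energy `∫ p |g'|²` by `Re ⟨g, A_p g⟩` (`lintegral_energy_le`), which
is at most `Ω ‖g‖²` because the spectral support lies in `[0, Ω]` (`IsSpectralMeasureOf.form_le`).

Existence of a spectral measure is not needed: without one the projection is `0` by definition, the
Paley-Wiener space is trivial and every claim concerns `f = 0`. -/

namespace VarBandwidth

/-! ### Calculus of complex locally absolutely continuous functions. -/

theorem ACLoc.lipschitz_comp {F : ℝ → ℂ} (hF : ACLoc F) {φ : ℂ → ℝ}
    (hφ : ∀ z w, dist (φ z) (φ w) ≤ dist z w) (a b : ℝ) :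
    AbsolutelyContinuousOnInterval (fun t => φ (F t)) a b := by
  have h := hF a b
  unfold AbsolutelyContinuousOnInterval at h ⊢
  exact squeeze_zero (fun E => Finset.sum_nonneg fun i _ => dist_nonneg)
    (fun E => Finset.sum_le_sum fun i _ => hφ _ _) h

theorem ACLoc.re {F : ℝ → ℂ} (hF : ACLoc F) (a b : ℝ) :
    AbsolutelyContinuousOnInterval (fun t => (F t).re) a b :=
  hF.lipschitz_comp (fun z w => by
    rw [Real.dist_eq, ← Complex.sub_re, Complex.dist_eq]; exact Complex.abs_re_le_norm _) a b

theorem ACLoc.im {F : ℝ → ℂ} (hF : ACLoc F) (a b : ℝ) :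
    AbsolutelyContinuousOnInterval (fun t => (F t).im) a b :=
  hF.lipschitz_comp (fun z w => by
    rw [Real.dist_eq, ← Complex.sub_im, Complex.dist_eq]; exact Complex.abs_im_le_norm _) a b

theorem ACLoc.sub_const {F : ℝ → ℂ} (hF : ACLoc F) (c : ℂ) : ACLoc (fun t => F t - c) := by
  intro a b
  have h := hF a b
  unfold AbsolutelyContinuousOnInterval at h ⊢
  simpa [dist_sub_right] using h

/-- `Re (G · conj F)`, written in coordinates, is locally absolutely continuous. -/
theorem absolutelyContinuous_re_mul_conj {F G : ℝ → ℂ} (hF : ACLoc F) (hG : ACLoc G) (a b : ℝ) :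
    AbsolutelyContinuousOnInterval
      (fun t => (G t).re * (F t).re + (G t).im * (F t).im) a b :=
  ((hG.re a b).fun_mul (hF.re a b)).fun_add ((hG.im a b).fun_mul (hF.im a b))

theorem hasDerivAt_re {F : ℝ → ℂ} {F' : ℂ} {t : ℝ} (h : HasDerivAt F F' t) :
    HasDerivAt (fun t => (F t).re) F'.re t :=
  (Complex.reCLM.hasFDerivAt.comp_hasDerivAt t h)

theorem hasDerivAt_im {F : ℝ → ℂ} {F' : ℂ} {t : ℝ} (h : HasDerivAt F F' t) :
    HasDerivAt (fun t => (F t).im) F'.im t :=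
  (Complex.imCLM.hasFDerivAt.comp_hasDerivAt t h)

theorem hasDerivAt_re_mul_conj {F G : ℝ → ℂ} {F' G' : ℂ} {t : ℝ} (hF : HasDerivAt F F' t)
    (hG : HasDerivAt G G' t) :
    HasDerivAt (fun t => (G t).re * (F t).re + (G t).im * (F t).im)
      ((G'.re * (F t).re + G'.im * (F t).im) + ((G t).re * F'.re + (G t).im * F'.im)) t := by
  refine (((hasDerivAt_re hG).fun_mul (hasDerivAt_re hF)).fun_add
    ((hasDerivAt_im hG).fun_mul (hasDerivAt_im hF))).congr_deriv ?_
  ring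

theorem absolutelyContinuous_norm_sq {F : ℝ → ℂ} (hF : ACLoc F) (a b : ℝ) :
    AbsolutelyContinuousOnInterval (fun t => ‖F t‖ ^ 2) a b := by
  have h := absolutelyContinuous_re_mul_conj hF hF a b
  convert h using 2 with t
  rw [← Complex.normSq_eq_norm_sq, Complex.normSq_apply]

theorem hasDerivAt_norm_sq {F : ℝ → ℂ} {F' : ℂ} {t : ℝ} (hF : HasDerivAt F F' t) :
    HasDerivAt (fun t => ‖F t‖ ^ 2) (2 * (F'.re * (F t).re + F'.im * (F t).im)) t := by
  have h := hasDerivAt_re_mul_conj hF hF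
  convert h using 1
  · ext s
    rw [← Complex.normSq_eq_norm_sq, Complex.normSq_apply]
  · ring

/-- Expand `|z - r w|² ≥ 0`. In Wirtinger's inequality `z = F'`, `w = F` and `r` is the tangent
weight. -/
theorem two_mul_re_mul_le (z w : ℂ) (r : ℝ) :
    2 * (z.re * w.re + z.im * w.im) * r ≤ ‖z‖ ^ 2 + ‖w‖ ^ 2 * r ^ 2 := by
  rw [← Complex.normSq_eq_norm_sq, ← Complex.normSq_eq_norm_sq, Complex.normSq_apply,
    Complex.normSq_apply]
  nlinarith [sq_nonneg (z.re - w.re * r), sq_nonneg (z.im - w.im * r)]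

/-! ### Wirtinger's inequality with one vanishing endpoint. -/

/-- Wirtinger's inequality with a non-sharp constant: `k` stays below `π / (2 (d - c))`. -/
theorem sq_mul_integral_norm_sq_le {F : ℝ → ℂ} (hF : ACLoc F) {c d s m k : ℝ} (hcd : c ≤ d)
    (hsm : (s = c ∧ m = d) ∨ (s = d ∧ m = c)) (hs : F s = 0) (hk : 0 ≤ k)
    (hkd : k * (d - c) < Real.pi / 2)
    (hint : IntervalIntegrable (fun t => ‖deriv F t‖ ^ 2) volume c d) :
    k ^ 2 * ∫ t in c..d, ‖F t‖ ^ 2 ≤ ∫ t in c..d, ‖deriv F t‖ ^ 2 := by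
  have hcos : ∀ t ∈ Set.Icc c d, Real.cos (k * (m - t)) ≠ 0 := by
    intro t ht
    refine (Real.cos_pos_of_mem_Ioo ?_).ne'
    have h1 : |k * (m - t)| ≤ k * (d - c) := by
      rw [abs_mul, abs_of_nonneg hk]
      refine mul_le_mul_of_nonneg_left ?_ hk
      rw [abs_le]
      rcases hsm with ⟨-, rfl⟩ | ⟨-, rfl⟩ <;> constructor <;> linarith [ht.1, ht.2]
    have := abs_lt.1 (h1.trans_lt hkd)
    exact ⟨this.1, this.2⟩
  -- The weight `w = k tan (k (m - t))` solves the Riccati equation `w' = -(k² + w²)`, so `(|F|² w)'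
  -- ≤ |F'|² - k² |F|²` almost everywhere.
  have hw : ∀ t ∈ Set.Icc c d, HasDerivAt (fun t => k * Real.tan (k * (m - t)))
      (-(k ^ 2 * (1 + Real.tan (k * (m - t)) ^ 2))) t := by
    intro t ht
    have h0 : HasDerivAt (fun t => k * (m - t)) (-k) t := by
      simpa using ((hasDerivAt_id t).const_sub m).const_mul k
    have h1 := ((Real.hasDerivAt_tan (hcos t ht)).comp t h0).const_mul k
    refine h1.congr_deriv ?_
    have h2 : 1 + Real.tan (k * (m - t)) ^ 2 = 1 / Real.cos (k * (m - t)) ^ 2 := by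
      rw [Real.tan_eq_sin_div_cos]
      field_simp [hcos t ht]
      linarith [Real.sin_sq_add_cos_sq (k * (m - t))]
    rw [h2]; ring
  have hwac : AbsolutelyContinuousOnInterval (fun t => k * Real.tan (k * (m - t))) c d := by
    refine ContDiffOn.absolutelyContinuousOnInterval ?_
    rw [Set.uIcc_of_le hcd]
    refine contDiffOn_const.mul fun t ht => ?_
    exact ((Real.contDiffAt_tan.2 (hcos t ht)).comp t
      (contDiffAt_const.mul (contDiffAt_const.sub contDiffAt_id))).contDiffWithinAt
  have hN := absolutelyContinuous_norm_sq hF c d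
  have hprod := hN.fun_mul hwac
  have h0 := hprod.integral_deriv_eq_sub
  -- Both boundary terms vanish: `F` is zero at `s`, the tangent is zero at the opposite end `m`.
  have hbd : ‖F d‖ ^ 2 * (k * Real.tan (k * (m - d))) -
      ‖F c‖ ^ 2 * (k * Real.tan (k * (m - c))) = 0 := by
    rcases hsm with ⟨rfl, rfl⟩ | ⟨rfl, rfl⟩ <;> simp [hs]
  rw [hbd] at h0
  have hNi : IntervalIntegrable (fun t => ‖F t‖ ^ 2) volume c d :=
    hN.continuousOn.intervalIntegrable
  have hle : ∫ t in c..d, deriv (fun t => ‖F t‖ ^ 2 * (k * Real.tan (k * (m - t)))) t ≤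
      ∫ t in c..d, (‖deriv F t‖ ^ 2 - k ^ 2 * ‖F t‖ ^ 2) := by
    refine intervalIntegral.integral_mono_ae_restrict hcd hprod.intervalIntegrable_deriv
      (hint.sub (hNi.const_mul _)) ?_
    filter_upwards [ae_restrict_mem measurableSet_Icc,
      ae_restrict_of_ae hF.ae_differentiableAt] with t ht hd
    rw [((hasDerivAt_norm_sq hd.hasDerivAt).fun_mul (hw t ht)).deriv]
    have := two_mul_re_mul_le (deriv F t) (F t) (k * Real.tan (k * (m - t)))
    nlinarith
  rw [intervalIntegral.integral_sub hint (hNi.const_mul _), h0,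
    intervalIntegral.integral_const_mul] at hle
  linarith

/-- Wirtinger's inequality for a function that vanishes at one end of the interval. -/
theorem integral_norm_sq_le_of_eq_zero {F : ℝ → ℂ} (hF : ACLoc F) {c d s : ℝ} (hcd : c ≤ d)
    (hs : s = c ∨ s = d) (hs0 : F s = 0)
    (hint : IntervalIntegrable (fun t => ‖deriv F t‖ ^ 2) volume c d) :
    ∫ t in c..d, ‖F t‖ ^ 2 ≤
      (2 * (d - c) / Real.pi) ^ 2 * ∫ t in c..d, ‖deriv F t‖ ^ 2 := by
  rcases hcd.eq_or_lt with rfl | hlt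
  · simp
  have hpos : 0 < d - c := sub_pos.2 hlt
  have hsm : ∃ m, (s = c ∧ m = d) ∨ (s = d ∧ m = c) := by
    rcases hs with h | h
    · exact ⟨d, Or.inl ⟨h, rfl⟩⟩
    · exact ⟨c, Or.inr ⟨h, rfl⟩⟩
  obtain ⟨m, hsm⟩ := hsm
  set K := Real.pi / (2 * (d - c)) with hK
  have hKpos : 0 < K := by positivity
  -- At `k = K` the weight is singular at the end `s`, so the sharp constant is reached only as a
  -- limit from below.
  have hlim : Tendsto (fun k : ℝ => k ^ 2 * ∫ t in c..d, ‖F t‖ ^ 2) (𝓝[<] K)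
      (𝓝 (K ^ 2 * ∫ t in c..d, ‖F t‖ ^ 2)) :=
    tendsto_nhdsWithin_of_tendsto_nhds (Continuous.tendsto (by fun_prop) K)
  have hle : K ^ 2 * ∫ t in c..d, ‖F t‖ ^ 2 ≤ ∫ t in c..d, ‖deriv F t‖ ^ 2 := by
    refine le_of_tendsto hlim ?_
    filter_upwards [self_mem_nhdsWithin,
      mem_nhdsWithin_of_mem_nhds (Ioi_mem_nhds hKpos)] with k hk hk0
    refine sq_mul_integral_norm_sq_le hF hcd hsm hs0 (le_of_lt hk0) ?_ hint
    have : k * (d - c) < K * (d - c) := mul_lt_mul_of_pos_right hk hpos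
    rwa [show K * (d - c) = Real.pi / 2 by rw [hK]; field_simp] at this
  have hK2 : 2 * (d - c) / Real.pi = K⁻¹ := by rw [hK, inv_div]
  rw [hK2, inv_pow, ← div_eq_inv_mul, le_div_iff₀ (by positivity), mul_comm]
  exact hle

/-! ### Energy bound by integration by parts on the whole line. -/

theorem not_integrable_of_le_on_Ici {N : ℝ → ℝ} {T ε : ℝ} (hε : 0 < ε)
    (h : ∀ t, T ≤ t → ε ≤ N t) : ¬ Integrable N := by
  intro hN
  have h1 : IntegrableOn (fun _ : ℝ => ε) (Set.Ici T) := by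
    refine Integrable.mono' hN.integrableOn aestronglyMeasurable_const ?_
    filter_upwards [ae_restrict_mem measurableSet_Ici] with t ht
    rw [Real.norm_of_nonneg hε.le]
    exact h t ht
  rw [integrableOn_const_iff] at h1
  simp [hε.ne'] at h1

theorem not_integrable_of_le_on_Iic {N : ℝ → ℝ} {T ε : ℝ} (hε : 0 < ε)
    (h : ∀ t, t ≤ T → ε ≤ N t) : ¬ Integrable N := by
  intro hN
  have h1 : IntegrableOn (fun _ : ℝ => ε) (Set.Iic T) := by
    refine Integrable.mono' hN.integrableOn aestronglyMeasurable_const ?_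
    filter_upwards [ae_restrict_mem measurableSet_Iic] with t ht
    rw [Real.norm_of_nonneg hε.le]
    exact h t ht
  rw [integrableOn_const_iff] at h1
  simp [hε.ne'] at h1

section Energy

variable {p : ℝ → ℝ} {F G : ℝ → ℂ}

theorem deriv_norm_sq_eq (hp : ∀ t, 0 < p t) (hF : ACLoc F)
    (hpF : G =ᵐ[volume] fun t => (p t : ℂ) * deriv F t) :
    ∀ᵐ t, deriv (fun t => ‖F t‖ ^ 2) t =
      2 / p t * ((G t).re * (F t).re + (G t).im * (F t).im) := by
  filter_upwards [hpF, hF.ae_differentiableAt] with t hG hd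
  rw [(hasDerivAt_norm_sq hd.hasDerivAt).deriv, hG, Complex.re_ofReal_mul, Complex.im_ofReal_mul]
  field_simp [(hp t).ne']

/-- The boundary term `Re (p f' · conj f)` of a square-integrable `f` is nonpositive arbitrarily
far to the right: otherwise `|f|²` would be increasing. -/
theorem exists_ge_boundary_nonpos (hp : ∀ t, 0 < p t) (hF : ACLoc F)
    (hpF : G =ᵐ[volume] fun t => (p t : ℂ) * deriv F t)
    (hint : Integrable fun t => ‖F t‖ ^ 2) (T : ℝ) :
    ∃ b, T ≤ b ∧ (G b).re * (F b).re + (G b).im * (F b).im ≤ 0 := by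
  by_contra! hcon
  have hFT : 0 < ‖F T‖ ^ 2 := by
    have hne : F T ≠ 0 := fun h0 => by simpa [h0] using hcon T le_rfl
    positivity
  refine not_integrable_of_le_on_Ici (T := T) hFT (fun t ht => ?_) hint
  have h := (absolutelyContinuous_norm_sq hF T t).integral_deriv_eq_sub
  have h0 : 0 ≤ ∫ s in T..t, deriv (fun t => ‖F t‖ ^ 2) s := by
    refine intervalIntegral.integral_nonneg_of_ae_restrict ht ?_
    filter_upwards [ae_restrict_mem measurableSet_Icc,
      ae_restrict_of_ae (deriv_norm_sq_eq hp hF hpF)] with s hs hd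
    rw [hd]
    exact mul_nonneg (div_nonneg zero_le_two (hp s).le) (hcon s hs.1).le
  linarith

/-- Mirror image at `-∞`: a boundary term negative on all of `(-∞, T]` would make `|F|²` decreasing
there, hence bounded below by `|F T|² > 0`. -/
theorem exists_le_boundary_nonneg (hp : ∀ t, 0 < p t) (hF : ACLoc F)
    (hpF : G =ᵐ[volume] fun t => (p t : ℂ) * deriv F t)
    (hint : Integrable fun t => ‖F t‖ ^ 2) (T : ℝ) :
    ∃ a, a ≤ T ∧ 0 ≤ (G a).re * (F a).re + (G a).im * (F a).im := by
  by_contra! hcon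
  have hFT : 0 < ‖F T‖ ^ 2 := by
    have hne : F T ≠ 0 := fun h0 => by simpa [h0] using hcon T le_rfl
    positivity
  refine not_integrable_of_le_on_Iic (T := T) hFT (fun t ht => ?_) hint
  have h := (absolutelyContinuous_norm_sq hF t T).integral_deriv_eq_sub
  have h0 : 0 ≤ ∫ s in t..T, -deriv (fun t => ‖F t‖ ^ 2) s := by
    refine intervalIntegral.integral_nonneg_of_ae_restrict ht ?_
    filter_upwards [ae_restrict_mem measurableSet_Icc,
      ae_restrict_of_ae (deriv_norm_sq_eq hp hF hpF)] with s hs hd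
    rw [Pi.zero_apply, hd, ← mul_neg]
    exact mul_nonneg (div_nonneg zero_le_two (hp s).le) (neg_nonneg.2 (hcon s hs.2).le)
  rw [intervalIntegral.integral_neg] at h0
  linarith

/-- Pointwise form of the integration by parts for `-(p f')' conj f`. -/
theorem energy_density_eq (hF : ACLoc F) (hG : ACLoc G)
    (hpF : G =ᵐ[volume] fun t => (p t : ℂ) * deriv F t) :
    ∀ᵐ t, p t * ‖deriv F t‖ ^ 2 =
      deriv (fun t => (G t).re * (F t).re + (G t).im * (F t).im) t +
        ((-deriv G t).re * (F t).re + (-deriv G t).im * (F t).im) := by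
  filter_upwards [hpF, hF.ae_differentiableAt, hG.ae_differentiableAt] with t hGt hdF hdG
  rw [(hasDerivAt_re_mul_conj hdF.hasDerivAt hdG.hasDerivAt).deriv, hGt, Complex.re_ofReal_mul,
    Complex.im_ofReal_mul, ← Complex.normSq_eq_norm_sq, Complex.normSq_apply, Complex.neg_re,
    Complex.neg_im]
  ring

/-- The energy `∫ p |f'|²` is at most `Re ∫ -(p f')' conj f`. -/
theorem lintegral_energy_le (hp : ∀ t, 0 < p t) (hF : ACLoc F) (hG : ACLoc G)
    (hpF : G =ᵐ[volume] fun t => (p t : ℂ) * deriv F t)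
    (hint : Integrable fun t => ‖F t‖ ^ 2)
    (hr : Integrable fun t => (-deriv G t).re * (F t).re + (-deriv G t).im * (F t).im) :
    (∀ a b, IntervalIntegrable (fun t => p t * ‖deriv F t‖ ^ 2) volume a b) ∧
    ∫⁻ t, ENNReal.ofReal (p t * ‖deriv F t‖ ^ 2) ≤
      ENNReal.ofReal (∫ t, ((-deriv G t).re * (F t).re + (-deriv G t).im * (F t).im)) := by
  have hB := absolutelyContinuous_re_mul_conj hF hG
  have hD := energy_density_eq hF hG hpF
  -- Almost everywhere the density is the derivative of an absolutely continuous function plus an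
  -- integrable function.
  have hii : ∀ a b, IntervalIntegrable (fun t => p t * ‖deriv F t‖ ^ 2) volume a b := by
    intro a b
    refine ((hB a b).intervalIntegrable_deriv.add hr.intervalIntegrable).congr_ae ?_
    exact ae_restrict_of_ae (hD.mono fun t ht => ht.symm)
  refine ⟨hii, ?_⟩
  -- Exhausting the line by `(a n, b n]` with these endpoints makes the boundary contribution
  -- nonpositive, so no decay of `p F' · conj F` at infinity is required.
  have ha' := fun n : ℕ => exists_le_boundary_nonneg hp hF hpF hint (-(n : ℝ))
  have hb' := fun n : ℕ => exists_ge_boundary_nonpos hp hF hpF hint (n : ℝ)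
  choose a ha haB using ha'
  choose b hb hbB using hb'
  have hta : Tendsto a atTop atBot :=
    tendsto_atBot_mono ha (tendsto_neg_atTop_atBot.comp tendsto_natCast_atTop_atTop)
  have htb : Tendsto b atTop atTop := tendsto_atTop_mono hb tendsto_natCast_atTop_atTop
  have hcov : AECover (volume : Measure ℝ) atTop fun n => Set.Ioc (a n) (b n) :=
    aecover_Ioc hta htb
  have hab : ∀ n, a n ≤ b n := fun n => by
    have : (0 : ℝ) ≤ n := Nat.cast_nonneg n
    linarith [ha n, hb n]
  have hmeas : AEMeasurable fun t => ENNReal.ofReal (p t * ‖deriv F t‖ ^ 2) := by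
    refine AEMeasurable.ennreal_ofReal ?_
    have h1 : LocallyIntegrable (fun t => p t * ‖deriv F t‖ ^ 2) (volume : Measure ℝ) := by
      intro t
      refine ⟨Set.Icc (t - 1) (t + 1), Icc_mem_nhds (by linarith) (by linarith), ?_⟩
      exact (intervalIntegrable_iff_integrableOn_Icc_of_le (by linarith)).1 (hii _ _)
    exact h1.aestronglyMeasurable.aemeasurable
  have hlim1 := hcov.lintegral_tendsto_of_countably_generated hmeas
  have hlim2 := (ENNReal.continuous_ofReal.tendsto _).comp
    (hcov.integral_tendsto_of_countably_generated hr)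
  refine le_of_tendsto_of_tendsto' hlim1 hlim2 fun n => ?_
  rw [← ofReal_integral_eq_lintegral_ofReal]
  · refine ENNReal.ofReal_le_ofReal ?_
    beta_reduce
    rw [← intervalIntegral.integral_of_le (hab n), ← intervalIntegral.integral_of_le (hab n),
      intervalIntegral.integral_congr_ae (hD.mono fun t ht _ => ht),
      intervalIntegral.integral_add (hB _ _).intervalIntegrable_deriv hr.intervalIntegrable,
      (hB _ _).integral_deriv_eq_sub]
    linarith [haB n, hbB n]
  · exact (intervalIntegrable_iff_integrableOn_Ioc_of_le (hab n)).1 (hii _ _)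
  · exact Eventually.of_forall fun t => mul_nonneg (hp t).le (sq_nonneg _)

end Energy

/-! ### Scalar spectral measures and the quadratic form. -/

section Spectral

variable {H : Type*} [NormedAddCommGroup H] [InnerProductSpace ℂ H] [CompleteSpace H]

namespace ProjectionValuedMeasure

theorem scalarMeasure_apply (E : ProjectionValuedMeasure H) (f : H) {S : Set ℝ}
    (hS : MeasurableSet S) :
    E.scalarMeasure f S = ENNReal.ofReal (inner ℂ f (E.proj S f)).re :=
  Measure.ofMeasurable_apply S hS

theorem scalarMeasure_univ (E : ProjectionValuedMeasure H) (f : H) :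
    E.scalarMeasure f Set.univ = ENNReal.ofReal (‖f‖ ^ 2) := by
  rw [E.scalarMeasure_apply f MeasurableSet.univ, E.univ]
  congr 1
  exact inner_self_eq_norm_sq (𝕜 := ℂ) f

instance (E : ProjectionValuedMeasure H) (f : H) : IsFiniteMeasure (E.scalarMeasure f) :=
  ⟨by rw [E.scalarMeasure_univ]; exact ENNReal.ofReal_lt_top⟩

/-- The complement is null because `E(Sᶜ) f = E(Sᶜ) E(S) f = E(∅) f = 0`. -/
theorem ae_mem_scalarMeasure (E : ProjectionValuedMeasure H) {f : H} {S : Set ℝ}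
    (hS : MeasurableSet S) (hf : f = E.proj S f) : ∀ᵐ l ∂E.scalarMeasure f, l ∈ S := by
  rw [ae_iff]
  change E.scalarMeasure f Sᶜ = 0
  have h := E.inter Sᶜ S hS.compl hS
  rw [Set.compl_inter_self, E.empty] at h
  have h0 : E.proj Sᶜ f = 0 := by
    rw [hf]
    exact (congrArg (fun T : H →L[ℂ] H => T f) h).symm
  rw [E.scalarMeasure_apply f hS.compl, h0]
  simp

/-- Vectors with spectral support in `[0, Ω]` lie in the domain of `A`, and the quadratic form of
`A` is bounded by `Ω` on them. -/
theorem IsSpectralMeasureOf.form_le {E : ProjectionValuedMeasure H} {A : H →ₗ.[ℂ] H}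
    (hE : E.IsSpectralMeasureOf A) {Ω : ℝ} {S : Set ℝ} (hS : MeasurableSet S)
    (hSΩ : S ⊆ Set.Icc 0 Ω) {f : H} (hf : f = E.proj S f) :
    ∃ hf : f ∈ A.domain, (inner ℂ f (A ⟨f, hf⟩)).re ≤ Ω * ‖f‖ ^ 2 := by
  have hae := E.ae_mem_scalarMeasure hS hf
  have hdom : f ∈ A.domain := by
    rw [hE.mem_domain_iff]
    calc ∫⁻ l, ENNReal.ofReal (l ^ 2) ∂E.scalarMeasure f
        ≤ ∫⁻ _, ENNReal.ofReal (Ω ^ 2) ∂E.scalarMeasure f := by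
          refine lintegral_mono_ae (hae.mono fun l hl => ENNReal.ofReal_le_ofReal ?_)
          have := hSΩ hl
          exact pow_le_pow_left₀ this.1 this.2 2
      _ < ⊤ := by
          rw [lintegral_const]
          exact ENNReal.mul_lt_top ENNReal.ofReal_lt_top (measure_lt_top _ _)
  refine ⟨hdom, ?_⟩
  have h := hE.inner_apply ⟨f, hdom⟩
  change inner ℂ f (A ⟨f, hdom⟩) = _ at h
  rw [h, Complex.ofReal_re]
  calc ∫ l, l ∂E.scalarMeasure f ≤ ∫ _, Ω ∂E.scalarMeasure f := by
        refine integral_mono_ae ?_ (integrable_const _) (hae.mono fun l hl => (hSΩ hl).2)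
        refine Integrable.mono' (integrable_const Ω) aestronglyMeasurable_id
          (hae.mono fun l hl => ?_)
        rw [Real.norm_of_nonneg (hSΩ hl).1]
        exact (hSΩ hl).2
    _ = Ω * ‖f‖ ^ 2 := by
        rw [integral_const, Measure.real, E.scalarMeasure_univ,
          ENNReal.toReal_ofReal (sq_nonneg _), smul_eq_mul, mul_comm]

end ProjectionValuedMeasure

end Spectral

/-! ### Representatives of Paley-Wiener functions and their energy. -/

theorem integrable_norm_sq_of_ae_eq {f : L2R} {F : ℝ → ℂ} (hf : f =ᵐ[volume] F) :
    Integrable fun t => ‖F t‖ ^ 2 := by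
  have h := (memLp_two_iff_integrable_sq_norm (Lp.aestronglyMeasurable f)).1 (Lp.memLp f)
  refine h.congr ?_
  filter_upwards [hf] with t ht
  rw [ht]

/-- A representative of an element of the domain of `A_p`, together with its energy bound. -/
theorem SLRel.exists_energy_le {p : ℝ → ℝ} (hp : ∀ t, 0 < p t) {f g : L2R} (h : SLRel p f g) :
    ∃ F : ℝ → ℂ, ACLoc F ∧ f =ᵐ[volume] F ∧
      (∀ a b, IntervalIntegrable (fun t => p t * ‖deriv F t‖ ^ 2) volume a b) ∧
      ∫⁻ t, ENNReal.ofReal (p t * ‖deriv F t‖ ^ 2) ≤ ENNReal.ofReal (inner ℂ f g).re := by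
  obtain ⟨F, G, hF, hG, hf, hpF, hg⟩ := h
  have hae : (fun t => (inner ℂ (f t) (g t)).re) =ᵐ[volume]
      fun t => (-deriv G t).re * (F t).re + (-deriv G t).im * (F t).im := by
    filter_upwards [hf, hg] with t h1 h2
    rw [h1, h2, RCLike.inner_apply, ← Complex.star_def, Complex.mul_re]
    simp [sub_eq_add_neg]
  have hi : Integrable fun t => inner ℂ (f t) (g t) := L2.integrable_inner f g
  have hr := hi.re.congr hae
  obtain ⟨h1, h2⟩ := lintegral_energy_le hp hF hG hpF (integrable_norm_sq_of_ae_eq hf) hr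
  refine ⟨F, hF, hf, h1, h2.trans_eq ?_⟩
  rw [← integral_congr_ae hae, L2.inner_def]
  congr 1
  exact integral_re hi

/-- One `E` serves for all sets `S`; uniqueness of the spectral measure plays no role, since any
choice satisfies the estimates. -/
theorem spectralProjection_eq_proj {H : Type*} [NormedAddCommGroup H] [InnerProductSpace ℂ H]
    [CompleteSpace H] {A : H →ₗ.[ℂ] H}
    (h : ∃ E : ProjectionValuedMeasure H, E.IsSpectralMeasureOf A) :
    ∃ E : ProjectionValuedMeasure H, E.IsSpectralMeasureOf A ∧
      ∀ S, spectralProjection A S = E.proj S :=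
  ⟨h.choose, h.choose_spec, fun S => by rw [spectralProjection, dif_pos h]⟩

/-- Elements of the Paley-Wiener space have a locally absolutely continuous representative whose
energy is at most `Ω ‖f‖²`. -/
theorem exists_rep_of_mem_PW {p : ℝ → ℝ} (hp : ∀ t, 0 < p t)
    (hE : ∃ E : ProjectionValuedMeasure L2R, E.IsSpectralMeasureOf (slOperator p))
    {Ω : ℝ} {L : Set ℝ} (hL_meas : MeasurableSet L) (hL : L ⊆ Set.Icc 0 Ω) {f : L2R}
    (hf : f ∈ PW p L) :
    ∃ F : ℝ → ℂ, ACLoc F ∧ f =ᵐ[volume] F ∧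
      (∀ a b, IntervalIntegrable (fun t => p t * ‖deriv F t‖ ^ 2) volume a b) ∧
      ∫⁻ t, ENNReal.ofReal (p t * ‖deriv F t‖ ^ 2) ≤ ENNReal.ofReal (Ω * ‖f‖ ^ 2) := by
  obtain ⟨E, hEA, hEP⟩ := spectralProjection_eq_proj hE
  have hf' : f = E.proj L f := by rw [← hEP]; exact hf
  obtain ⟨hdom, hle⟩ := hEA.form_le hL_meas hL hf'
  have hrel : SLRel p f (slOperator p ⟨f, hdom⟩) :=
    (mem_graph_slOperator p _ _).1 ((slOperator p).mem_graph ⟨f, hdom⟩)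
  obtain ⟨F, hF, hfF, hii, hen⟩ := hrel.exists_energy_le hp
  exact ⟨F, hF, hfF, hii, hen.trans (ENNReal.ofReal_le_ofReal hle)⟩

theorem isStarProjection_pwProj {p : ℝ → ℝ} {L : Set ℝ} (hL : MeasurableSet L) :
    IsStarProjection (pwProj p L) := by
  by_cases hE : ∃ E : ProjectionValuedMeasure L2R, E.IsSpectralMeasureOf (slOperator p)
  · obtain ⟨E, -, hEP⟩ := spectralProjection_eq_proj hE
    rw [pwProj, hEP]
    exact E.isStarProjection L hL
  · rw [pwProj, spectralProjection, dif_neg hE]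
    exact IsStarProjection.zero _

theorem pwProj_mem_PW {p : ℝ → ℝ} {L : Set ℝ} (hL : MeasurableSet L) (u : L2R) :
    pwProj p L u ∈ PW p L :=
  (congrArg (fun T : L2R →L[ℂ] L2R => T u) (isStarProjection_pwProj hL).isIdempotentElem).symm

theorem norm_pwProj_le {p : ℝ → ℝ} {L : Set ℝ} (hL : MeasurableSet L) (u : L2R) :
    ‖pwProj p L u‖ ≤ ‖u‖ := by
  have h := (pwProj p L).le_of_opNorm_le (isStarProjection_pwProj (p := p) hL).norm_le u
  rwa [one_mul] at h

theorem sub_mem_PW {p : ℝ → ℝ} {L : Set ℝ} {f g : L2R} (hf : f ∈ PW p L) (hg : g ∈ PW p L) :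
    f - g ∈ PW p L := by
  change f - g = pwProj p L (f - g)
  rw [map_sub, ← (show f = pwProj p L f from hf), ← (show g = pwProj p L g from hg)]

/-- Continuous functions that agree almost everywhere are equal, so the choice in `pointValue` is
immaterial. -/
theorem pointValue_eq {f : L2R} {F : ℝ → ℂ} (hF : Continuous F) (hf : f =ᵐ[volume] F) :
    pointValue f = F := by
  have h : HasContRep f := ⟨F, hF, hf⟩
  have h1 : pointValue f = h.choose := by
    funext t
    rw [pointValue, dif_pos h]
  rw [h1]
  exact (h.choose_spec.1.ae_eq_iff_eq (μ := (volume : Measure ℝ)) hF).1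
    (h.choose_spec.2.symm.trans hf)

/-! ### The cells around the sampling points and the sampling error. -/

section Cells

variable {x : ℤ → ℝ}

/-- The interval `[y_{i-1}, y_i)` of points whose sample is taken at `x_i`. -/
def cell (x : ℤ → ℝ) (i : ℤ) : Set ℝ := Set.Ico (midpt x (i - 1)) (midpt x i)

theorem measurableSet_cell (x : ℤ → ℝ) (i : ℤ) : MeasurableSet (cell x i) := measurableSet_Ico

theorem monotone_midpt (hx : Monotone x) : Monotone (midpt x) := fun i j hij => by
  have h1 := hx hij
  have h2 := hx (add_le_add_left hij 1)
  unfold midpt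
  linarith

theorem pairwise_disjoint_cell (hx : Monotone x) :
    Pairwise (Function.onFun Disjoint (cell x)) := by
  exact (monotone_midpt hx).pairwise_disjoint_on_Ico_pred

theorem le_midpt (hx : Monotone x) (i : ℤ) : x i ≤ midpt x i := by
  have := hx (show i ≤ i + 1 by lia)
  unfold midpt
  linarith

theorem midpt_le (hx : Monotone x) (i : ℤ) : midpt x i ≤ x (i + 1) := by
  have := hx (show i ≤ i + 1 by lia)
  unfold midpt
  linarith

theorem midpt_pred_le (hx : Monotone x) (i : ℤ) : midpt x (i - 1) ≤ x i := by
  simpa using midpt_le hx (i - 1)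

theorem iUnion_cell (hx : Monotone x) (hx_top : Tendsto x atTop atTop)
    (hx_bot : Tendsto x atBot atBot) : ⋃ i, cell x i = Set.univ := by
  refine Set.eq_univ_of_forall fun t => Set.mem_iUnion.2 ?_
  obtain ⟨n, hn⟩ := (hx_top.eventually_gt_atTop t).exists
  obtain ⟨m, hm⟩ := (hx_bot.eventually_lt_atBot t).exists
  -- The cell containing `t` has the least index `i` with `t < y_i`; minimality gives `y_{i-1} ≤ t`.
  obtain ⟨i, hi, hmin⟩ := Int.exists_least_of_bdd (P := fun i => t < midpt x i)
    ⟨m - 1, fun j hj => by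
      by_contra hlt
      have h1 := hx (show j + 1 ≤ m by lia)
      exact absurd (hj.trans_le ((midpt_le hx j).trans h1)) (not_lt.2 hm.le)⟩
    ⟨n, hn.trans_le (le_midpt hx n)⟩
  refine ⟨i, not_lt.1 fun h => ?_, hi⟩
  have := hmin _ h
  lia

theorem stepFun_eq_of_mem (hx : Monotone x) (c : ℤ → ℂ) {i : ℤ} {t : ℝ} (ht : t ∈ cell x i) :
    stepFun x c t = c i := by
  have h1 : ∀ j, j ≠ i → c j * chi x j t = 0 := by
    intro j hj
    have : t ∉ Set.Ico (midpt x (j - 1)) (midpt x j) :=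
      fun h => Set.disjoint_left.1 (pairwise_disjoint_cell hx hj) h ht
    rw [chi, Set.indicator_of_notMem this, mul_zero]
  rw [stepFun, tsum_eq_single i h1, chi, Set.indicator_of_mem (show t ∈ Set.Ico _ _ from ht)]
  simp

theorem aestronglyMeasurable_stepFun (hx : Monotone x) (hx_top : Tendsto x atTop atTop)
    (hx_bot : Tendsto x atBot atBot) (c : ℤ → ℂ) :
    AEStronglyMeasurable (stepFun x c) (volume : Measure ℝ) := by
  rw [← Measure.restrict_univ (μ := (volume : Measure ℝ)), ← iUnion_cell hx hx_top hx_bot,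
    aestronglyMeasurable_iUnion_iff]
  intro i
  refine (aestronglyMeasurable_const (b := c i)).congr ?_
  filter_upwards [ae_restrict_mem (measurableSet_cell x i)] with t ht
  exact (stepFun_eq_of_mem hx c ht).symm

/-- On an interval inside `[x_j, x_{j+1}]` that is at most half as long and has the sampling point
as an endpoint, Wirtinger's inequality and the gap condition bound the sampling error. -/
theorem setLIntegral_sampling_error_le {p : ℝ → ℝ} {c₀ : ℝ} (hc₀ : 0 < c₀) (hp : ∀ t, c₀ ≤ p t)
    {F : ℝ → ℂ} (hF : ACLoc F)
    (hii : ∀ a b, IntervalIntegrable (fun t => p t * ‖deriv F t‖ ^ 2) volume a b)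
    {δ : ℝ} {j : ℤ} (hx : Monotone x) (hδ : weightedGap p x j ≤ δ) {a b s : ℝ}
    (hab : a ≤ b) (hs : s = a ∨ s = b) (hja : x j ≤ a) (hbj : b ≤ x (j + 1))
    (hlen : 2 * (b - a) ≤ x (j + 1) - x j) :
    ∫⁻ t in Set.Ico a b, ‖F t - F s‖ₑ ^ 2 ≤
      ENNReal.ofReal ((δ / Real.pi) ^ 2) *
        ∫⁻ t in Set.Ico a b, ENNReal.ofReal (p t * ‖deriv F t‖ ^ 2) := by
  have hderiv : deriv (fun t => F t - F s) = deriv F := funext fun t => deriv_sub_const _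
  -- The lower bound `c₀` on `p` turns finite local energy into local square integrability of `F'`.
  have hdi : IntervalIntegrable (fun t => ‖deriv F t‖ ^ 2) volume a b := by
    refine ((hii a b).const_mul c₀⁻¹).mono_fun
      ((measurable_deriv F).norm.pow_const 2).aestronglyMeasurable ?_
    refine Eventually.of_forall fun t => ?_
    have h0 : 0 ≤ ‖deriv F t‖ ^ 2 := sq_nonneg _
    have h1 : 0 ≤ p t * ‖deriv F t‖ ^ 2 := mul_nonneg (hc₀.le.trans (hp t)) h0
    beta_reduce
    rw [Real.norm_of_nonneg h0, Real.norm_of_nonneg (by positivity), ← div_eq_inv_mul,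
      le_div_iff₀ hc₀, mul_comm]
    exact mul_le_mul_of_nonneg_right (hp t) h0
  have hW := integral_norm_sq_le_of_eq_zero (hF.sub_const (F s)) hab hs (sub_self _)
    (by rwa [hderiv])
  rw [hderiv] at hW
  have hxj : x j ≤ x (j + 1) := hx (by lia)
  set q := ⨅ t : Set.Icc (x j) (x (j + 1)), √(p t) with hq
  have : Nonempty (Set.Icc (x j) (x (j + 1))) := ⟨⟨x j, le_rfl, hxj⟩⟩
  have hbdd : BddBelow (Set.range fun t : Set.Icc (x j) (x (j + 1)) => √(p t)) :=
    ⟨0, by rintro _ ⟨t, rfl⟩; exact Real.sqrt_nonneg _⟩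
  have hqpos : 0 < q :=
    (Real.sqrt_pos.2 hc₀).trans_le (le_ciInf fun t => Real.sqrt_le_sqrt (hp t))
  have hqp : ∀ t ∈ Set.Icc a b, q ^ 2 ≤ p t := by
    intro t ht
    have h1 : q ≤ √(p t) := ciInf_le hbdd ⟨t, hja.trans ht.1, ht.2.trans hbj⟩
    calc q ^ 2 ≤ √(p t) ^ 2 := pow_le_pow_left₀ hqpos.le h1 2
      _ = p t := Real.sq_sqrt (hc₀.le.trans (hp t))
  have hgap : x (j + 1) - x j ≤ δ * q := (div_le_iff₀ hqpos).1 hδ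
  have hreal : ∫ t in a..b, ‖F t - F s‖ ^ 2 ≤
      (δ / Real.pi) ^ 2 * ∫ t in a..b, p t * ‖deriv F t‖ ^ 2 := by
    have hI0 : 0 ≤ ∫ t in a..b, ‖deriv F t‖ ^ 2 :=
      intervalIntegral.integral_nonneg hab fun t _ => sq_nonneg _
    -- The factor 2 in Wirtinger's constant is absorbed by the half-gap length; then the gap is at
    -- most `δ q`, and `q² ≤ p` restores the energy density.
    calc ∫ t in a..b, ‖F t - F s‖ ^ 2
        ≤ (2 * (b - a) / Real.pi) ^ 2 * ∫ t in a..b, ‖deriv F t‖ ^ 2 := hW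
      _ ≤ (δ * q / Real.pi) ^ 2 * ∫ t in a..b, ‖deriv F t‖ ^ 2 := by
          refine mul_le_mul_of_nonneg_right (pow_le_pow_left₀ ?_ ?_ 2) hI0
          · have := Real.pi_pos
            have := sub_nonneg.2 hab
            positivity
          · exact div_le_div_of_nonneg_right (hlen.trans hgap) Real.pi_pos.le
      _ = (δ / Real.pi) ^ 2 * ∫ t in a..b, q ^ 2 * ‖deriv F t‖ ^ 2 := by
          rw [intervalIntegral.integral_const_mul]; ring
      _ ≤ _ := by
          refine mul_le_mul_of_nonneg_left ?_ (sq_nonneg _)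
          exact intervalIntegral.integral_mono_on hab (hdi.const_mul _) (hii a b)
            fun t ht => mul_le_mul_of_nonneg_right (hqp t ht) (sq_nonneg _)
  have hl : ∫⁻ t in Set.Ico a b, ‖F t - F s‖ₑ ^ 2 =
      ENNReal.ofReal (∫ t in a..b, ‖F t - F s‖ ^ 2) := by
    rw [intervalIntegral.integral_of_le hab, ofReal_integral_eq_lintegral_ofReal]
    · rw [setLIntegral_congr Ico_ae_eq_Ioc]
      refine lintegral_congr fun t => ?_
      rw [ENNReal.ofReal_pow (norm_nonneg _), ofReal_norm]
    · refine (intervalIntegrable_iff_integrableOn_Ioc_of_le hab).1 ?_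
      have := hF.continuous
      exact Continuous.intervalIntegrable (by fun_prop) a b
    · exact Eventually.of_forall fun t => sq_nonneg _
  have hr : ∫⁻ t in Set.Ico a b, ENNReal.ofReal (p t * ‖deriv F t‖ ^ 2) =
      ENNReal.ofReal (∫ t in a..b, p t * ‖deriv F t‖ ^ 2) := by
    rw [intervalIntegral.integral_of_le hab, ofReal_integral_eq_lintegral_ofReal]
    · rw [setLIntegral_congr Ico_ae_eq_Ioc]
    · exact (intervalIntegrable_iff_integrableOn_Ioc_of_le hab).1 (hii a b)
    · exact Eventually.of_forall fun t => mul_nonneg (hc₀.le.trans (hp t)) (sq_nonneg _)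
  rw [hl, hr, ← ENNReal.ofReal_mul (sq_nonneg _)]
  exact ENNReal.ofReal_le_ofReal hreal

/-- The total sampling error is bounded by the energy. -/
theorem lintegral_sub_stepFun_le {p : ℝ → ℝ} {c₀ : ℝ} (hc₀ : 0 < c₀) (hp : ∀ t, c₀ ≤ p t)
    {F : ℝ → ℂ} (hF : ACLoc F)
    (hii : ∀ a b, IntervalIntegrable (fun t => p t * ‖deriv F t‖ ^ 2) volume a b)
    (hx : Monotone x) (hx_top : Tendsto x atTop atTop) (hx_bot : Tendsto x atBot atBot)
    {δ : ℝ} (hδ : ∀ j, weightedGap p x j ≤ δ) :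
    ∫⁻ t, ‖F t - stepFun x (fun i => F (x i)) t‖ₑ ^ 2 ≤
      ENNReal.ofReal ((δ / Real.pi) ^ 2) *
        ∫⁻ t, ENNReal.ofReal (p t * ‖deriv F t‖ ^ 2) := by
  have hsplit : ∀ u : ℝ → ENNReal, ∫⁻ t, u t = ∑' i, ∫⁻ t in cell x i, u t := by
    intro u
    rw [← lintegral_iUnion (measurableSet_cell x) (pairwise_disjoint_cell hx),
      iUnion_cell hx hx_top hx_bot, Measure.restrict_univ]
  rw [hsplit, hsplit, ← ENNReal.tsum_mul_left]
  refine ENNReal.tsum_le_tsum fun i => ?_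
  -- The part of the cell left of `x i` belongs to gap `i - 1`, the right part to gap `i`; each
  -- fills half of its gap.
  have hcell : ∀ u : ℝ → ENNReal, ∫⁻ t in cell x i, u t =
      (∫⁻ t in Set.Ico (midpt x (i - 1)) (x i), u t) + ∫⁻ t in Set.Ico (x i) (midpt x i), u t := by
    intro u
    rw [← lintegral_union measurableSet_Ico (Set.Ico_disjoint_Ico_same),
      Set.Ico_union_Ico_eq_Ico (midpt_pred_le hx i) (le_midpt hx i), cell]
  have hstep : ∫⁻ t in cell x i, ‖F t - stepFun x (fun i => F (x i)) t‖ₑ ^ 2 =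
      ∫⁻ t in cell x i, ‖F t - F (x i)‖ₑ ^ 2 := by
    refine setLIntegral_congr_fun (measurableSet_cell x i) fun t ht => ?_
    rw [stepFun_eq_of_mem hx _ ht]
  rw [hstep, hcell, hcell, mul_add]
  have hi : i - 1 + 1 = i := by lia
  refine add_le_add ?_ ?_
  · refine setLIntegral_sampling_error_le hc₀ hp hF hii hx (hδ (i - 1)) (midpt_pred_le hx i)
      (Or.inr rfl) (le_midpt hx _) (by rw [hi]) ?_
    rw [midpt, hi]
    linarith
  · refine setLIntegral_sampling_error_le hc₀ hp hF hii hx (hδ i) (le_midpt hx i)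
      (Or.inl rfl) le_rfl (midpt_le hx i) ?_
    rw [midpt]
    linarith

end Cells

theorem eLpNorm_two_le_ofReal {u : ℝ → ℂ} {C : ℝ} (hC : 0 ≤ C)
    (h : ∫⁻ t, ‖u t‖ₑ ^ 2 ≤ ENNReal.ofReal (C ^ 2)) :
    eLpNorm u 2 (volume : Measure ℝ) ≤ ENNReal.ofReal C := by
  have h1 := eLpNorm_nnreal_pow_eq_lintegral (f := u) (μ := (volume : Measure ℝ))
    (p := 2) two_ne_zero
  simp only [NNReal.coe_ofNat, ENNReal.rpow_ofNat, ENNReal.coe_ofNat] at h1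
  rw [← h1, ENNReal.ofReal_pow hC] at h
  exact (ENNReal.pow_le_pow_left_iff two_ne_zero).1 h

theorem stepL2_ae_eq {x : ℤ → ℝ} {c : ℤ → ℂ}
    (h : MemLp (stepFun x c) 2 (volume : Measure ℝ)) : stepL2 x c =ᵐ[volume] stepFun x c := by
  rw [stepL2, dif_pos h]
  exact h.coeFn_toLp

/-- The sampling error of an element of the Paley-Wiener space. -/
theorem sampling_error_le {p : ℝ → ℝ} {c₀ : ℝ} (hc₀ : 0 < c₀) (hp : ∀ t, c₀ ≤ p t)
    (hE : ∃ E : ProjectionValuedMeasure L2R, E.IsSpectralMeasureOf (slOperator p))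
    {Ω : ℝ} (hΩ : 0 ≤ Ω) {L : Set ℝ} (hL_meas : MeasurableSet L) (hL : L ⊆ Set.Icc 0 Ω)
    {x : ℤ → ℝ} (hx : Monotone x) (hx_top : Tendsto x atTop atTop)
    (hx_bot : Tendsto x atBot atBot) {δ : ℝ} (hδ₀ : 0 ≤ δ) (hδ : ∀ j, weightedGap p x j ≤ δ)
    {g : L2R} (hg : g ∈ PW p L) :
    HasContRep g ∧ MemLp (stepFun x (samples x g)) 2 (volume : Measure ℝ) ∧
      ‖g - stepL2 x (samples x g)‖ ≤ δ * √Ω / Real.pi * ‖g‖ := by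
  obtain ⟨F, hF, hgF, hii, hen⟩ :=
    exists_rep_of_mem_PW (fun t => hc₀.trans_le (hp t)) hE hL_meas hL hg
  have hsam : samples x g = fun i => F (x i) := by
    funext i
    rw [samples, pointValue_eq hF.continuous hgF]
  have hC : 0 ≤ δ * √Ω / Real.pi * ‖g‖ := by
    have := Real.pi_pos
    positivity
  have hlin : ∫⁻ t, ‖F t - stepFun x (samples x g) t‖ₑ ^ 2 ≤
      ENNReal.ofReal ((δ * √Ω / Real.pi * ‖g‖) ^ 2) := by
    rw [hsam]
    refine (lintegral_sub_stepFun_le hc₀ hp hF hii hx hx_top hx_bot hδ).trans ?_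
    refine (mul_le_mul_right hen _).trans_eq ?_
    rw [← ENNReal.ofReal_mul (sq_nonneg _)]
    congr 1
    calc (δ / Real.pi) ^ 2 * (Ω * ‖g‖ ^ 2) = (δ / Real.pi) ^ 2 * (√Ω ^ 2 * ‖g‖ ^ 2) := by
          rw [Real.sq_sqrt hΩ]
      _ = _ := by ring
  have hnorm := eLpNorm_two_le_ofReal hC hlin
  have hmF : MemLp F 2 (volume : Measure ℝ) := (Lp.memLp g).ae_eq hgF
  have hmD : MemLp (fun t => F t - stepFun x (samples x g) t) 2 (volume : Measure ℝ) :=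
    ⟨hF.continuous.aestronglyMeasurable.sub
      (aestronglyMeasurable_stepFun hx hx_top hx_bot _), hnorm.trans_lt ENNReal.ofReal_lt_top⟩
  -- The step function is `F` minus the sampling error, both square-integrable.
  have hmS : MemLp (stepFun x (samples x g)) 2 (volume : Measure ℝ) := by
    refine (hmF.sub hmD).ae_eq (Eventually.of_forall fun t => ?_)
    simp
  refine ⟨⟨F, hF.continuous, hgF⟩, hmS, ?_⟩
  rw [Lp.norm_def]
  refine ENNReal.toReal_le_of_le_ofReal hC ?_
  refine (eLpNorm_congr_ae ?_).trans_le hnorm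
  filter_upwards [Lp.coeFn_sub g (stepL2 x (samples x g)), hgF, stepL2_ae_eq hmS] with t h1 h2 h3
  rw [h1, Pi.sub_apply, h2, h3]

/-! ### Linearity of sampling and the abstract iteration. -/

theorem samples_sub {x : ℤ → ℝ} {f g : L2R} (hf : HasContRep f) (hg : HasContRep g) :
    samples x (f - g) = fun i => samples x f i - samples x g i := by
  obtain ⟨F, hF, hfF⟩ := hf
  obtain ⟨G, hG, hgG⟩ := hg
  funext i
  have h : (f - g : L2R) =ᵐ[volume] fun t => F t - G t := by
    filter_upwards [Lp.coeFn_sub f g, hfF, hgG] with t h1 h2 h3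
    rw [h1, Pi.sub_apply, h2, h3]
  rw [samples, samples, samples, pointValue_eq (hF.sub hG) h, pointValue_eq hF hfF,
    pointValue_eq hG hgG]
  rfl

/-- The default value `0` of `stepL2` would spoil additivity, hence the two integrability
hypotheses. -/
theorem stepL2_sub {x : ℤ → ℝ} (hx : Monotone x) (hx_top : Tendsto x atTop atTop)
    (hx_bot : Tendsto x atBot atBot) {c d : ℤ → ℂ}
    (hc : MemLp (stepFun x c) 2 (volume : Measure ℝ))
    (hd : MemLp (stepFun x d) 2 (volume : Measure ℝ)) :
    stepL2 x (fun i => c i - d i) = stepL2 x c - stepL2 x d := by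
  have hfun : stepFun x (fun i => c i - d i) = stepFun x c - stepFun x d := by
    funext t
    obtain ⟨i, hi⟩ := Set.mem_iUnion.1
      ((iUnion_cell hx hx_top hx_bot).symm ▸ Set.mem_univ t : t ∈ ⋃ i, cell x i)
    rw [Pi.sub_apply, stepFun_eq_of_mem hx _ hi, stepFun_eq_of_mem hx _ hi,
      stepFun_eq_of_mem hx _ hi]
  have hm : MemLp (stepFun x (fun i => c i - d i)) 2 (volume : Measure ℝ) :=
    hfun ▸ hc.sub hd
  refine Lp.ext ?_
  filter_upwards [stepL2_ae_eq hm, stepL2_ae_eq hc, stepL2_ae_eq hd,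
    Lp.coeFn_sub (stepL2 x c) (stepL2 x d)] with t h1 h2 h3 h4
  rw [h1, h4, Pi.sub_apply, h2, h3, hfun, Pi.sub_apply]

/-- Convergence of the iteration `h₀ = V f`, `h_{n+1} = h_n - V h_n` when `I - V` contracts the
subspace `W` by a factor `γ < 1`. -/
theorem iteration_converges {H : Type*} [NormedAddCommGroup H] [CompleteSpace H] {W : Set H}
    {V : H → H} (hW : ∀ f ∈ W, ∀ g ∈ W, f - g ∈ W) (hVW : ∀ f ∈ W, V f ∈ W)
    (hV : ∀ f ∈ W, ∀ g ∈ W, V (f - g) = V f - V g) {γ : ℝ} (hγ₀ : 0 ≤ γ) (hγ : γ < 1)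
    (hVγ : ∀ f ∈ W, ‖f - V f‖ ≤ γ * ‖f‖) {f : H} (hf : f ∈ W) {h a : ℕ → H}
    (h0 : h 0 = V f) (hsucc : ∀ n, h (n + 1) = h n - V (h n))
    (a0 : a 0 = h 0) (asucc : ∀ n, a (n + 1) = a n + h (n + 1)) :
    (∀ n, h n ∈ W) ∧ Tendsto a atTop (𝓝 f) ∧ HasSum h f ∧
      ∀ n, ‖f - a n‖ ≤ γ ^ (n + 1) * ‖f‖ := by
  have hh : ∀ n, h n ∈ W := by
    intro n
    induction n with
    | zero => rw [h0]; exact hVW f hf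
    | succ n ih => rw [hsucc]; exact hW _ ih _ (hVW _ ih)
  -- The next increment is `V` applied to the current error, so the errors evolve by `I - V`.
  have he : ∀ n, f - a n ∈ W ∧ h (n + 1) = V (f - a n) := by
    intro n
    induction n with
    | zero =>
      rw [a0, h0]
      refine ⟨hW _ hf _ (hVW f hf), ?_⟩
      rw [hV _ hf _ (hVW f hf), hsucc, h0]
    | succ n ih =>
      have heq : f - a (n + 1) = (f - a n) - h (n + 1) := by rw [asucc]; abel
      refine ⟨heq ▸ hW _ ih.1 _ (hh _), ?_⟩
      rw [heq, hV _ ih.1 _ (hh _), ← ih.2]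
      exact hsucc (n + 1)
  have herr : ∀ n, ‖f - a n‖ ≤ γ ^ (n + 1) * ‖f‖ := by
    intro n
    induction n with
    | zero => rw [a0, h0, zero_add, pow_one]; exact hVγ f hf
    | succ n ih =>
      have heq : f - a (n + 1) = (f - a n) - V (f - a n) := by rw [asucc, (he n).2]; abel
      calc ‖f - a (n + 1)‖ ≤ γ * ‖f - a n‖ := by rw [heq]; exact hVγ _ (he n).1
        _ ≤ γ * (γ ^ (n + 1) * ‖f‖) := mul_le_mul_of_nonneg_left ih hγ₀
        _ = γ ^ (n + 1 + 1) * ‖f‖ := by ring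
  have hlim : Tendsto a atTop (𝓝 f) := by
    rw [tendsto_iff_norm_sub_tendsto_zero]
    refine squeeze_zero (fun n => norm_nonneg _)
      (fun n => (norm_sub_rev (a n) f).trans_le (herr n)) ?_
    simpa using ((tendsto_pow_atTop_nhds_zero_of_lt_one hγ₀ hγ).comp
      (tendsto_add_atTop_nat 1)).mul_const ‖f‖
  -- Geometric decay gives absolute convergence: `HasSum` asks for more than convergence of the
  -- partial sums `a n`.
  have hbound : ∀ n, ‖h n‖ ≤ ‖h 0‖ * γ ^ n := by
    intro n
    induction n with
    | zero => simp
    | succ n ih =>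
      calc ‖h (n + 1)‖ ≤ γ * ‖h n‖ := by rw [hsucc]; exact hVγ _ (hh n)
        _ ≤ γ * (‖h 0‖ * γ ^ n) := mul_le_mul_of_nonneg_left ih hγ₀
        _ = ‖h 0‖ * γ ^ (n + 1) := by ring
  have hsum : Summable h :=
    Summable.of_norm_bounded ((summable_geometric_of_lt_one hγ₀ hγ).mul_left _) hbound
  have hpart : ∀ n, ∑ i ∈ Finset.range (n + 1), h i = a n := by
    intro n
    induction n with
    | zero => simp [a0]
    | succ n ih => rw [Finset.sum_range_succ, ih, asucc]
  have hts : HasSum h f := by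
    have h1 := hsum.hasSum.tendsto_sum_nat.comp (tendsto_add_atTop_nat 1)
    have h2 : Tendsto a atTop (𝓝 (∑' n, h n)) := by
      refine h1.congr fun n => ?_
      exact hpart n
    rw [← tendsto_nhds_unique h2 hlim]
    exact hsum.hasSum
  exact ⟨hh, hlim, hts, herr⟩

theorem PW_eq_zero_of_forall_not {p : ℝ → ℝ}
    (hE : ¬ ∃ E : ProjectionValuedMeasure L2R, E.IsSpectralMeasureOf (slOperator p))
    {L : Set ℝ} {g : L2R} (hg : g ∈ PW p L) : g = 0 := by
  have h : g = pwProj p L g := hg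
  rw [h, pwProj, spectralProjection, dif_neg hE]
  rfl

/-- Serves the degenerate case in which the Paley-Wiener space is `{0}`. -/
theorem sampling_zero (x : ℤ → ℝ) :
    HasContRep 0 ∧ MemLp (stepFun x (samples x 0)) 2 (volume : Measure ℝ) ∧
      stepL2 x (samples x 0) = 0 := by
  have h0 : (0 : L2R) =ᵐ[volume] fun _ : ℝ => (0 : ℂ) := Lp.coeFn_zero ℂ 2 volume
  have hstep : stepFun x (samples x 0) = fun _ => 0 := by
    funext t
    simp [stepFun, samples, pointValue_eq continuous_const h0]
  have hm : MemLp (stepFun x (samples x 0)) 2 (volume : Measure ℝ) := by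
    rw [hstep]; exact MemLp.zero'
  refine ⟨⟨fun _ => 0, continuous_const, h0⟩, hm, Lp.ext ?_⟩
  refine (stepL2_ae_eq hm).trans ?_
  rw [hstep]
  exact h0.symm

/-- The sampling error estimate on the Paley-Wiener space. The proof has its content in the case
that `A_p` has a spectral measure; otherwise the Paley-Wiener space is trivial. -/
theorem sampling_error_le_of_mem_PW {p : ℝ → ℝ} {c₀ : ℝ} (hc₀ : 0 < c₀) (hp : ∀ t, c₀ ≤ p t)
    {Ω : ℝ} (hΩ : 0 ≤ Ω) {L : Set ℝ} (hL_meas : MeasurableSet L) (hL : L ⊆ Set.Icc 0 Ω)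
    {x : ℤ → ℝ} (hx : Monotone x) (hx_top : Tendsto x atTop atTop)
    (hx_bot : Tendsto x atBot atBot) {δ : ℝ} (hδ₀ : 0 ≤ δ) (hδ : ∀ j, weightedGap p x j ≤ δ)
    {g : L2R} (hg : g ∈ PW p L) :
    HasContRep g ∧ MemLp (stepFun x (samples x g)) 2 (volume : Measure ℝ) ∧
      ‖g - stepL2 x (samples x g)‖ ≤ δ * √Ω / Real.pi * ‖g‖ := by
  by_cases hE : ∃ E : ProjectionValuedMeasure L2R, E.IsSpectralMeasureOf (slOperator p)
  · exact sampling_error_le hc₀ hp hE hΩ hL_meas hL hx hx_top hx_bot hδ₀ hδ hg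
  · obtain ⟨h1, h2, h3⟩ := sampling_zero x
    rw [PW_eq_zero_of_forall_not hE hg]
    exact ⟨h1, h2, by rw [h3]; simp⟩

end VarBandwidth

/-! ### Convergence of the reconstruction algorithm. -/

theorem mainTheorem4 (p : ℝ → ℝ) (hp_meas : AEMeasurable p (volume : Measure ℝ))
    (hp_inf : ∃ c : ℝ, 0 < c ∧ ∀ t, c ≤ p t)
    (Ω : ℝ) (hΩ : 0 < Ω) (L : Set ℝ) (hL_meas : MeasurableSet L) (hL : L ⊆ Set.Icc 0 Ω)
    (x : ℤ → ℝ) (hx_mono : Monotone x)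
    (hx_top : Tendsto x atTop atTop) (hx_bot : Tendsto x atBot atBot)
    (δ : ℝ) (hδ : IsLUB (Set.range (VarBandwidth.weightedGap p x)) δ)
    (hgap : δ < Real.pi / √Ω) :
    -- point evaluation and the step functions make sense on the Paley-Wiener space
    (∀ g ∈ VarBandwidth.PW p L, VarBandwidth.HasContRep g ∧
      MemLp (VarBandwidth.stepFun x (VarBandwidth.samples x g)) 2 (volume : Measure ℝ)) ∧
    ∀ f ∈ VarBandwidth.PW p L,
      (∀ n, VarBandwidth.increment p L x (VarBandwidth.samples x f) n ∈ VarBandwidth.PW p L) ∧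
      Tendsto (VarBandwidth.approx p L x (VarBandwidth.samples x f)) atTop (𝓝 f) ∧
      HasSum (VarBandwidth.increment p L x (VarBandwidth.samples x f)) f ∧
      ∀ n : ℕ, ‖f - VarBandwidth.approx p L x (VarBandwidth.samples x f) n‖ ≤
        (δ * √Ω / Real.pi) ^ (n + 1) * ((Real.pi + δ * √Ω) / (Real.pi - δ * √Ω)) * ‖f‖ := by
  obtain ⟨c₀, hc₀, hp⟩ := hp_inf
  have hδ' : ∀ j, VarBandwidth.weightedGap p x j ≤ δ := fun j => hδ.1 ⟨j, rfl⟩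
  have hδ₀ : 0 ≤ δ := by
    refine le_trans (div_nonneg (sub_nonneg.2 (hx_mono (by lia))) ?_) (hδ' 0)
    exact Real.iInf_nonneg fun t => Real.sqrt_nonneg _
  have hΩ' : 0 < √Ω := Real.sqrt_pos.2 hΩ
  have hlt : δ * √Ω < Real.pi := (lt_div_iff₀ hΩ').1 hgap
  have hS := fun g (hg : g ∈ VarBandwidth.PW p L) => VarBandwidth.sampling_error_le_of_mem_PW
    hc₀ hp hΩ.le hL_meas hL hx_mono hx_top hx_bot hδ₀ hδ' hg
  refine ⟨fun g hg => ⟨(hS g hg).1, (hS g hg).2.1⟩, fun f hf => ?_⟩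
  have hγ₀ : 0 ≤ δ * √Ω / Real.pi := div_nonneg (mul_nonneg hδ₀ hΩ'.le) Real.pi_pos.le
  obtain ⟨h1, h2, h3, h4⟩ := VarBandwidth.iteration_converges (W := VarBandwidth.PW p L)
    (V := fun g => VarBandwidth.pwProj p L (VarBandwidth.stepL2 x (VarBandwidth.samples x g)))
    (fun f hf g hg => VarBandwidth.sub_mem_PW hf hg)
    (fun f _ => VarBandwidth.pwProj_mem_PW hL_meas _)
    (fun f hf g hg => by
      rw [VarBandwidth.samples_sub (hS f hf).1 (hS g hg).1,
        VarBandwidth.stepL2_sub hx_mono hx_top hx_bot (hS f hf).2.1 (hS g hg).2.1, map_sub])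
    hγ₀ ((div_lt_one Real.pi_pos).2 hlt)
    (fun f hf => by
      have hPf : f = VarBandwidth.pwProj p L f := hf
      calc _ = ‖VarBandwidth.pwProj p L
            (f - VarBandwidth.stepL2 x (VarBandwidth.samples x f))‖ := by rw [map_sub, ← hPf]
        _ ≤ ‖f - VarBandwidth.stepL2 x (VarBandwidth.samples x f)‖ :=
            VarBandwidth.norm_pwProj_le hL_meas _
        _ ≤ _ := (hS f hf).2.2)
    hf (h := VarBandwidth.increment p L x (VarBandwidth.samples x f))
    (a := VarBandwidth.approx p L x (VarBandwidth.samples x f)) rfl (fun _ => rfl) rfl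
    (fun _ => rfl)
  refine ⟨h1, h2, h3, fun n => (h4 n).trans ?_⟩
  -- The iteration already gives the error `γ ^ (n + 1) ‖f‖`; the extra quotient is at least 1 and
  -- only weakens it.
  have hratio : 1 ≤ (Real.pi + δ * √Ω) / (Real.pi - δ * √Ω) := by
    rw [one_le_div (sub_pos.2 hlt)]
    linarith [mul_nonneg hδ₀ hΩ'.le]
  exact mul_le_mul_of_nonneg_right
    (le_mul_of_one_le_right (pow_nonneg hγ₀ _) hratio) (norm_nonneg _)
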